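/- For integers $t\ge 1$ and $n\ge 1$ let $\tau_t(n)$ be the number of $t$-tuples $(d_1,\ldots,d_t)$ of positive integers with $d_1\cdots d_t=n$. For $t\ge 2$ let $\vartheta_t$ denote the exponent in the Piltz divisor problem for $\tau_t$, that is, the infimum of the real numbers $\theta$ for which there is a real polynomial $P_t$ of degree $t-1$ with leading coefficient $1/(t-1)!$ such that, for every $\varepsilon>0$, $$\sum_{n\le x}\tau_t(n)=x\,P_t(\log x)+O\bigl(x^{\theta+\varepsilon}\bigr)\qquad (x\to\infty).$$ Let $r\ge 2$ and $t_1,\ldots,t_r\ge 2$ be fixed integers. Then the infinite product over the primes $$\Delta=\Delta(\tau_{t_1},\ldots,\tau_{t_r},1,\ldots,1)=\prod_p\Biggl(1+(-1)^{r-1}\sum_{\substack{1\le a_i\le t_i\\ (1\le i\le r)}}\frac{1}{p^{a_1+\cdots+a_r}}\prod_{i=1}^r(-1)^{a_i}\binom{t_i}{a_i}\Biggr)$$ converges unconditionally, and there is a real polynomial $Q$ of degree $t_1+\cdots+t_r-r$ with leading coefficient $$\frac{\Delta}{(t_1-1)!\cdots(t_r-1)!},$$ depending only on $r,t_1,\ldots,t_r$,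 such that for every $\varepsilon>0$, $$\sum_{\substack{1\le n_1,\ldots,n_r\le x\\ \gcd(n_1,\ldots,n_r)=1}}\tau_{t_1}(n_1)\cdots\tau_{t_r}(n_r)=x^r\,Q(\log x)+O\bigl(x^{\,r-1+\max_{1\le i\le r}\vartheta_{t_i}+\varepsilon}\bigr)\qquad (x\to\infty),$$ where the constant implied by the $O$-symbol may depend on $r$, $t_1,\ldots,t_r$ and $\varepsilon$. -/

import Mathlib

open Filter Asymptotics

/-- The Piltz divisor function `τ_t(n)`: the number of `t`-tuples `(d_1, …, d_t)` of positive
integers with `d_1 ⋯ d_t = n` (for `n ≥ 1`). -/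
def piltzTau (t n : ℕ) : ℕ := (Nat.finMulAntidiag t n).card

/-- `θ` is an admissible exponent in the Piltz divisor problem for `τ_t`: there is a polynomial
`P` of degree `t - 1` with leading coefficient `1 / (t - 1)!` such that, for every `ε > 0`,
`∑_{n ≤ x} τ_t(n) = x P(log x) + O(x ^ (θ + ε))` as `x → ∞`. -/
def IsPiltzExponent (t : ℕ) (θ : ℝ) : Prop :=
  ∃ P : Polynomial ℝ, P.natDegree = t - 1 ∧ P.leadingCoeff = 1 / ((t - 1).factorial : ℝ) ∧
    ∀ ε : ℝ, 0 < ε →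
      (fun x : ℝ => (∑ n ∈ Finset.Icc 1 ⌊x⌋₊, (piltzTau t n : ℝ)) - x * P.eval (Real.log x))
        =O[atTop] fun x : ℝ => x ^ (θ + ε)

/-- The exponent `ϑ_t` in the Piltz divisor problem for `τ_t`: the infimum of the admissible
exponents. For `t ≥ 2` it is a genuine infimum: `θ = t` is admissible, and no `θ < 0` is, since the
sum jumps by at least `1` at every positive integer. -/
noncomputable def piltzExponent (t : ℕ) : ℝ := sInf {θ : ℝ | IsPiltzExponent t θ}

/-- The sum of `τ_{t_1}(n_1) ⋯ τ_{t_r}(n_r)` over the positive integers `n_1, …, n_r ≤ x` with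
`gcd(n_1, …, n_r) = 1`. -/
noncomputable def coprimeTauSum {r : ℕ} (t : Fin r → ℕ) (x : ℝ) : ℝ :=
  ∑ n ∈ Fintype.piFinset (fun _ : Fin r => Finset.Icc 1 ⌊x⌋₊) with Finset.univ.gcd n = 1,
    ∏ i, (piltzTau (t i) (n i) : ℝ)

/-- The factor at `p` of the Euler product `Δ(τ_{t_1}, …, τ_{t_r}, 1, …, 1)`. Restricting to
`a_i ≤ t_i` only drops terms with `binom(t_i, a_i) = 0`. -/
noncomputable def deltaFactor {r : ℕ} (t : Fin r → ℕ) (p : ℕ) : ℝ :=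
  1 + (-1) ^ (r - 1) * ∑ a ∈ Fintype.piFinset (fun i : Fin r => Finset.Icc 1 (t i)),
    (1 / (p : ℝ) ^ (∑ i, a i)) * ∏ i, ((-1) ^ (a i) * ((t i).choose (a i) : ℝ))

/-- `Δ(τ_{t_1}, …, τ_{t_r}, 1, …, 1)`, the product of these factors over all primes. -/
noncomputable def deltaOne {r : ℕ} (t : Fin r → ℕ) : ℝ :=
  ∏' p : Nat.Primes, deltaFactor t (p : ℕ)

/-! ### Piltz functions as convolution powers of zeta -/

open scoped ArithmeticFunction.zeta

/-! Write T_i(x) for the sum of τ_{t_i}(n) over n ≤ x, and D_p F(x) = F(x/p). Inclusion–exclusion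
over the primes dividing the gcd gives ∑_s (-1)^|s| ∏_i R_{i,s} T_i(x), with s running over finite
sets of primes and R_{i,s} = ∏_{p ∈ s} (1 - (1 - D_p)^{t_i}). Indeed, removing the multiples of p
from the convolution power ζ^t amounts to convolving it with (1 - δ_p)^t, and convolution with δ_p
acts on summatory functions as D_p (`sum_piltzTau_dvd`, `coprimeTauSum_eq_sum`). Sets s containing a
prime above x contribute 0, so the sum runs over all s and no tail is cut off.

Now replace T_i by x P_i(log x). On functions bounded by a weight w with w(y/p) ≤ p^(-a) w(y),
R_{i,s} gains 2^t p^(-a) for each prime (`abs_radicalOperator_le`). In the difference of products,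
one factor is a Piltz remainder, with a = σ slightly above the largest exponent, and r - 1 factors
have a = 1 - δ. Since r ≥ 2, the total σ + (r-1)(1-δ) can be kept above 1, so the errors are
summable over s. The main terms keep the form x P(log x), and their top coefficients sum to the
Euler product Δ (`exists_polynomial_hasSum_prod_radicalOperator`).

This requires the largest exponent to be below 1; the infimum is then attained. Otherwise the
permitted error exceeds both sides and the formula is trivial, so no nontrivial bound in the divisor
problem is needed. -/

open ArithmeticFunction in
lemma piltzTau_eq_zeta_pow (t n : ℕ) :
    (piltzTau t n : ℝ) = ((ζ : ArithmeticFunction ℝ) ^ t) n := by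
  induction t generalizing n with
  | zero =>
    by_cases hn : n = 1
    · subst hn
      simp [piltzTau, Nat.finMulAntidiag_one]
    · simp [piltzTau, Nat.finMulAntidiag_zero_left hn, one_apply_ne hn]
  | succ t ih =>
    have key : piltzTau (t + 1) n = ∑ a ∈ n.divisors, piltzTau t (n / a) := by
      unfold piltzTau
      rw [← Finset.card_sigma]
      refine Finset.card_bij' (fun f _ => ⟨f 0, Fin.tail f⟩) (fun g _ => Fin.cons g.1 g.2)
        ?_ ?_ ?_ ?_
      · intro f hf
        rw [Nat.mem_finMulAntidiag, Fin.prod_univ_succ] at hf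
        obtain ⟨hf, hn⟩ := hf
        subst hf
        have h0 : 0 < f 0 := Nat.pos_of_ne_zero (left_ne_zero_of_mul hn)
        simp only [Finset.mem_sigma, Nat.mem_divisors, Nat.mem_finMulAntidiag,
          Nat.mul_div_cancel_left _ h0]
        exact ⟨⟨dvd_mul_right _ _, hn⟩, rfl, right_ne_zero_of_mul hn⟩
      · rintro ⟨a, g⟩ hg
        simp only [Finset.mem_sigma, Nat.mem_divisors, Nat.mem_finMulAntidiag] at hg
        rw [Nat.mem_finMulAntidiag, Fin.prod_univ_succ]
        simp only [Fin.cons_zero, Fin.cons_succ, hg.2.1]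
        exact ⟨Nat.mul_div_cancel' hg.1.1, hg.1.2⟩
      · intro f _
        exact Fin.cons_self_tail f
      · rintro ⟨a, g⟩ _
        simp
    rw [key, pow_succ', mul_apply, Nat.sum_divisorsAntidiagonal
      (f := fun a b => (ζ : ArithmeticFunction ℝ) a * ((ζ : ArithmeticFunction ℝ) ^ t) b)]
    push_cast
    refine Finset.sum_congr rfl fun a ha => ?_
    have : a ≠ 0 := (Nat.pos_of_mem_divisors ha).ne'
    rw [ih, natCoe_apply, zeta_apply_ne this]
    simp

/-! ### Divisibility conditions as convolutions and dilations -/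

/-- The summatory function `x ↦ ∑_{n ≤ x} f n`. -/
noncomputable def summatory : ArithmeticFunction ℝ →ₗ[ℝ] (ℝ → ℝ) where
  toFun f x := ∑ n ∈ Finset.Icc 1 ⌊x⌋₊, f n
  map_add' f g := by
    ext x
    simp [Finset.sum_add_distrib]
  map_smul' c f := by
    ext x
    simp [Finset.mul_sum]

lemma summatory_apply (f : ArithmeticFunction ℝ) (x : ℝ) :
    summatory f x = ∑ n ∈ Finset.Icc 1 ⌊x⌋₊, f n := rfl

/-- The arithmetic function with value `1` at the prime `p` and `0` elsewhere. -/
noncomputable def primeDelta (p : Nat.Primes) : ArithmeticFunction ℝ :=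
  ⟨fun n => if n = (p : ℕ) then 1 else 0, if_neg p.2.ne_zero.symm⟩

lemma primeDelta_apply (p : Nat.Primes) (n : ℕ) :
    primeDelta p n = if n = (p : ℕ) then 1 else 0 := rfl

lemma primeDelta_mul_apply (p : Nat.Primes) (f : ArithmeticFunction ℝ) (n : ℕ) :
    (primeDelta p * f) n = if (p : ℕ) ∣ n then f (n / p) else 0 := by
  rw [ArithmeticFunction.mul_apply, Nat.sum_divisorsAntidiagonal
    (f := fun a b => primeDelta p a * f b)]
  rcases eq_or_ne n 0 with rfl | hn
  · simp
  · simp [primeDelta_apply, hn]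

/-- The dilation operator `F ↦ (x ↦ F (x / p))`. -/
noncomputable def dilation (p : Nat.Primes) : Module.End ℝ (ℝ → ℝ) where
  toFun F x := F (x / p)
  map_add' _ _ := rfl
  map_smul' _ _ := rfl

lemma dilation_apply (p : Nat.Primes) (F : ℝ → ℝ) (x : ℝ) : dilation p F x = F (x / p) := rfl

lemma summatory_primeDelta_mul (p : Nat.Primes) (f : ArithmeticFunction ℝ) :
    summatory (primeDelta p * f) = dilation p (summatory f) := by
  ext x
  have hp := p.2.pos
  rw [dilation_apply, summatory_apply, summatory_apply, Nat.floor_div_natCast]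
  simp only [primeDelta_mul_apply]
  rw [← Finset.sum_filter]
  symm
  refine Finset.sum_bij' (fun m _ => (p : ℕ) * m) (fun n _ => n / p) ?_ ?_ ?_ ?_ ?_
  · intro m hm
    rw [Finset.mem_Icc, Nat.le_div_iff_mul_le hp] at hm
    rw [Finset.mem_filter, Finset.mem_Icc, mul_comm]
    exact ⟨⟨Nat.mul_pos hm.1 hp, hm.2⟩, dvd_mul_left _ _⟩
  · intro n hn
    rw [Finset.mem_filter, Finset.mem_Icc] at hn
    rw [Finset.mem_Icc]
    exact ⟨Nat.div_pos (Nat.le_of_dvd hn.1.1 hn.2) hp, Nat.div_le_div_right hn.1.2⟩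
  · intro m _
    exact Nat.mul_div_cancel_left _ hp
  · intro n hn
    exact Nat.mul_div_cancel' (Finset.mem_filter.mp hn).2
  · intro m _
    rw [Nat.mul_div_cancel_left _ hp]

/-- Restriction of an arithmetic function to the integers not divisible by the prime `p`. -/
noncomputable def sieve (p : Nat.Primes) : ArithmeticFunction ℝ →+* ArithmeticFunction ℝ where
  toFun f := ⟨fun n => if (p : ℕ) ∣ n then 0 else f n, by simp⟩
  map_one' := by
    ext n
    by_cases hn : n = 1
    · subst hn
      simp [p.2.ne_one]
    · simp [ArithmeticFunction.one_apply_ne hn]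
  map_zero' := by
    ext n
    simp
  map_add' f g := by
    ext n
    change (if (p : ℕ) ∣ n then 0 else f n + g n) =
      (if (p : ℕ) ∣ n then 0 else f n) + (if (p : ℕ) ∣ n then 0 else g n)
    split_ifs <;> simp
  -- Primality of p enters here: p ∤ ab exactly when p divides neither a nor b.
  map_mul' f g := by
    ext n
    refine Eq.trans ?_ ArithmeticFunction.mul_apply.symm
    simp only [ArithmeticFunction.mul_apply, ArithmeticFunction.coe_mk]
    by_cases h : (p : ℕ) ∣ n
    · rw [if_pos h]
      refine (Finset.sum_eq_zero (M := ℝ) fun ab hab => ?_).symm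
      rw [← (Nat.mem_divisorsAntidiagonal.mp hab).1, p.2.dvd_mul] at h
      rcases h with h | h <;> simp [h]
    · rw [if_neg h]
      refine Finset.sum_congr rfl fun ab hab => ?_
      rw [← (Nat.mem_divisorsAntidiagonal.mp hab).1, p.2.dvd_mul, not_or] at h
      simp [h]

lemma sieve_apply (p : Nat.Primes) (f : ArithmeticFunction ℝ) (n : ℕ) :
    sieve p f n = if (p : ℕ) ∣ n then 0 else f n := rfl

open ArithmeticFunction in
lemma sieve_zeta (p : Nat.Primes) :
    sieve p (ζ : ArithmeticFunction ℝ) = (1 - primeDelta p) * (ζ : ArithmeticFunction ℝ) := by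
  ext n
  rw [sub_mul, one_mul, sub_eq_add_neg, ArithmeticFunction.add_apply, ArithmeticFunction.neg_apply,
    primeDelta_mul_apply, sieve_apply]
  rcases eq_or_ne n 0 with rfl | hn
  · simp
  · by_cases h : (p : ℕ) ∣ n
    · have : n / p ≠ 0 := (Nat.div_pos (Nat.le_of_dvd (Nat.pos_of_ne_zero hn) h) p.2.pos).ne'
      simp [h, hn, natCoe_apply, zeta_apply, this]
    · simp [h]

lemma sieve_primeDelta {p q : Nat.Primes} (h : q ≠ p) : sieve p (primeDelta q) = primeDelta q := by
  ext n
  rw [sieve_apply, primeDelta_apply]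
  by_cases hn : n = (q : ℕ)
  · subst hn
    rw [if_neg]
    rw [Nat.prime_dvd_prime_iff_eq p.2 q.2]
    exact fun h' => h (Subtype.ext h'.symm)
  · simp [hn]

/-- The arithmetic function `∏_{p ∈ l} (1 - (1 - δ_p) ^ t)`. -/
noncomputable def radicalKernel (t : ℕ) (l : List Nat.Primes) : ArithmeticFunction ℝ :=
  (l.map fun p => 1 - (1 - primeDelta p) ^ t).prod

/-- The operator `∏_{p ∈ l} (1 - (1 - D_p) ^ t)`, where `D_p` is the dilation by `p`. -/
noncomputable def radicalOperator (t : ℕ) (l : List Nat.Primes) : Module.End ℝ (ℝ → ℝ) :=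
  (l.map fun p => 1 - (1 - dilation p) ^ t).prod

lemma sieve_radicalKernel (t : ℕ) {p : Nat.Primes} {l : List Nat.Primes} (h : p ∉ l) :
    sieve p (radicalKernel t l) = radicalKernel t l := by
  unfold radicalKernel
  rw [map_list_prod, List.map_map]
  congr 1
  refine List.map_congr_left fun q hq => ?_
  have : q ≠ p := fun h' => h (h' ▸ hq)
  simp [sieve_primeDelta this]

-- Adjoining p subtracts the restriction to integers prime to p. That restriction fixes the kernel
-- of the other primes, which is why the list has no repetition, and turns ζ^t into (1 - δ_p)^t ζ^t.
open ArithmeticFunction in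
lemma radicalKernel_mul_zeta_pow_apply (t : ℕ) {l : List Nat.Primes} (hl : l.Nodup) (n : ℕ) :
    (radicalKernel t l * (ζ : ArithmeticFunction ℝ) ^ t) n =
      if ∀ p ∈ l, (p : ℕ) ∣ n then ((ζ : ArithmeticFunction ℝ) ^ t) n else 0 := by
  induction l with
  | nil => simp [radicalKernel]
  | cons p l ih =>
    rw [List.nodup_cons] at hl
    have h1 : radicalKernel t (p :: l) * (ζ : ArithmeticFunction ℝ) ^ t =
        radicalKernel t l * (ζ : ArithmeticFunction ℝ) ^ t -
          sieve p (radicalKernel t l * (ζ : ArithmeticFunction ℝ) ^ t) := by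
      rw [map_mul, map_pow, sieve_radicalKernel t hl.1, sieve_zeta, mul_pow]
      simp only [radicalKernel, List.map_cons, List.prod_cons]
      ring
    rw [h1, sub_eq_add_neg, ArithmeticFunction.add_apply, ArithmeticFunction.neg_apply, sieve_apply,
      ih hl.2]
    by_cases hp : (p : ℕ) ∣ n <;> simp [hp]

lemma summatory_radicalKernel_mul (t : ℕ) (l : List Nat.Primes) (f : ArithmeticFunction ℝ) :
    summatory (radicalKernel t l * f) = radicalOperator t l (summatory f) := by
  have hpow : ∀ (p : Nat.Primes) (k : ℕ) (f : ArithmeticFunction ℝ),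
      summatory ((1 - primeDelta p) ^ k * f) = ((1 - dilation p) ^ k) (summatory f) := by
    intro p k
    induction k with
    | zero => intro f; simp
    | succ k ih =>
      intro f
      rw [pow_succ, pow_succ, mul_assoc, ih, Module.End.mul_apply, sub_mul, one_mul, map_sub,
        summatory_primeDelta_mul]
      rfl
  induction l with
  | nil => simp [radicalKernel, radicalOperator]
  | cons p l ih =>
    simp only [radicalKernel, radicalOperator, List.map_cons, List.prod_cons] at ih ⊢
    rw [mul_assoc, sub_mul, one_mul, map_sub, hpow, ih]
    rfl

open ArithmeticFunction in
/-- The sum of `τ_t(n)` over the `n ≤ x` divisible by every prime of `s`, expressed through the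
dilations of `x ↦ ∑_{n ≤ x} τ_t(n)`. -/
lemma sum_piltzTau_dvd (t : ℕ) (s : Finset Nat.Primes) (x : ℝ) :
    ∑ n ∈ Finset.Icc 1 ⌊x⌋₊, (if ∀ p ∈ s, (p : ℕ) ∣ n then (piltzTau t n : ℝ) else 0) =
      radicalOperator t s.toList (summatory ((ζ : ArithmeticFunction ℝ) ^ t)) x := by
  rw [← summatory_radicalKernel_mul, summatory_apply]
  refine Finset.sum_congr rfl fun n _ => ?_
  rw [radicalKernel_mul_zeta_pow_apply t s.nodup_toList, piltzTau_eq_zeta_pow]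
  simp

/-! ### Inclusion–exclusion over the gcd -/

/-- The primes up to `N`. -/
def primesUpTo (N : ℕ) : Finset Nat.Primes := Finset.subtype Nat.Prime (Finset.range (N + 1))

lemma mem_primesUpTo {N : ℕ} {p : Nat.Primes} : p ∈ primesUpTo N ↔ (p : ℕ) ≤ N := by
  exact Finset.mem_subtype.trans (Finset.mem_range.trans Nat.lt_succ_iff)

/-- Expand ∏_{p ≤ N} (1 - 1[p divides every n_i]). Primes up to N suffice because a prime dividing
the gcd divides the first entry, which is at most N. -/
lemma indicator_gcd_eq_one {r : ℕ} (hr : 0 < r) {N : ℕ} {n : Fin r → ℕ}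
    (hn : ∀ i, n i ∈ Finset.Icc 1 N) :
    (if Finset.univ.gcd n = 1 then (1 : ℝ) else 0) =
      ∑ s ∈ (primesUpTo N).powerset, (-1) ^ s.card * ∏ i, if ∀ p ∈ s, (p : ℕ) ∣ n i then 1 else 0 := by
  have h1 : (if Finset.univ.gcd n = 1 then (1 : ℝ) else 0) =
      ∏ p ∈ primesUpTo N, (1 - if ∀ i, (p : ℕ) ∣ n i then (1 : ℝ) else 0) := by
    split_ifs with h
    · refine (Finset.prod_eq_one fun p _ => ?_).symm
      rw [if_neg, sub_zero]
      intro hp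
      have : (p : ℕ) ∣ Finset.univ.gcd n := Finset.dvd_gcd fun i _ => hp i
      rw [h] at this
      exact p.2.one_lt.ne' (Nat.dvd_one.mp this)
    · obtain ⟨q, hq, hd⟩ := Nat.exists_prime_and_dvd h
      have hd' : ∀ i, q ∣ n i := fun i => hd.trans (Finset.gcd_dvd (Finset.mem_univ i))
      refine (Finset.prod_eq_zero (i := (⟨q, hq⟩ : Nat.Primes)) ?_ ?_).symm
      · have := Finset.mem_Icc.mp (hn ⟨0, hr⟩)
        exact mem_primesUpTo.mpr ((Nat.le_of_dvd this.1 (hd' _)).trans this.2)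
      · rw [if_pos hd', sub_self]
  simp only [h1, sub_eq_add_neg]
  rw [Finset.prod_one_add]
  refine Finset.sum_congr rfl fun s _ => ?_
  rw [Finset.prod_neg]
  congr 1
  simp only [Finset.prod_ite_zero, Finset.prod_const_one]
  congr 1
  simp only [Finset.mem_univ, true_implies]
  exact propext ⟨fun h i p hp => h p hp i, fun h p hp i => h i p hp⟩

open ArithmeticFunction in
/-- Inclusion–exclusion over the primes dividing the greatest common divisor. -/
lemma coprimeTauSum_eq_sum {r : ℕ} (hr : 0 < r) (t : Fin r → ℕ) (x : ℝ) :
    coprimeTauSum t x = ∑ s ∈ (primesUpTo ⌊x⌋₊).powerset, (-1) ^ s.card *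
      ∏ i, radicalOperator (t i) s.toList (summatory ((ζ : ArithmeticFunction ℝ) ^ t i)) x := by
  simp only [← sum_piltzTau_dvd]
  rw [coprimeTauSum, Finset.sum_filter]
  simp only [Finset.prod_univ_sum, Finset.mul_sum]
  rw [Finset.sum_comm]
  refine Finset.sum_congr rfl fun n hn => ?_
  rw [← mul_boole, indicator_gcd_eq_one hr (Fintype.mem_piFinset.mp hn), Finset.mul_sum]
  refine Finset.sum_congr rfl fun s _ => ?_
  rw [mul_left_comm, ← Finset.prod_mul_distrib]
  simp

-- No positive n ≤ x is divisible by a prime above x. This turns the finite inclusion–exclusion sum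
-- into a series over all s.
open ArithmeticFunction in
lemma radicalOperator_summatory_eq_zero (t : ℕ) {x : ℝ} {s : Finset Nat.Primes}
    (hs : s ∉ (primesUpTo ⌊x⌋₊).powerset) :
    radicalOperator t s.toList (summatory ((ζ : ArithmeticFunction ℝ) ^ t)) x = 0 := by
  rw [← sum_piltzTau_dvd]
  rw [Finset.mem_powerset, Finset.not_subset] at hs
  obtain ⟨p, hp, hpx⟩ := hs
  rw [mem_primesUpTo] at hpx
  refine Finset.sum_eq_zero fun n hn => if_neg fun h => hpx ?_
  rw [Finset.mem_Icc] at hn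
  exact (Nat.le_of_dvd hn.1 (h p hp)).trans hn.2

/-! ### Size of the radical operators -/

lemma one_sub_dilation_apply (p : Nat.Primes) (F : ℝ → ℝ) (x : ℝ) :
    (1 - dilation p) F x = F x - F (x / p) := rfl

lemma prime_rpow_neg_le_one (p : Nat.Primes) {a : ℝ} (ha : 0 ≤ a) : (p : ℝ) ^ (-a) ≤ 1 :=
  Real.rpow_le_one_of_one_le_of_nonpos (by exact_mod_cast p.2.one_le) (by linarith)

/-- The identity cancels in 1 - (1 - D_p)^t, so every surviving term contains a dilation and saves
p^(-a). Bounds are required for all y > 0 because dilations reach arguments below 1. -/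
lemma abs_radicalOperator_le (t : ℕ) {w : ℝ → ℝ} {a : ℝ} (ha : 0 ≤ a)
    (hw0 : ∀ y, 0 < y → 0 ≤ w y)
    (hw : ∀ (p : Nat.Primes) (y : ℝ), 0 < y → w (y / p) ≤ (p : ℝ) ^ (-a) * w y)
    {F : ℝ → ℝ} (hF : ∀ y, 0 < y → |F y| ≤ w y) (l : List Nat.Primes) (y : ℝ) (hy : 0 < y) :
    |radicalOperator t l F y| ≤ (l.map fun p : Nat.Primes => 2 ^ t * (p : ℝ) ^ (-a)).prod * w y := by
  have hdil : ∀ (p : Nat.Primes) (G : ℝ → ℝ) (C : ℝ), 0 ≤ C → (∀ y, 0 < y → |G y| ≤ C * w y) →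
      ∀ y, 0 < y → |G (y / p)| ≤ C * (p : ℝ) ^ (-a) * w y := by
    intro p G C hC hG y hy
    have hp : (0 : ℝ) < p := by exact_mod_cast p.2.pos
    refine (hG _ (div_pos hy hp)).trans ?_
    rw [mul_assoc]
    exact mul_le_mul_of_nonneg_left (hw p y hy) hC
  have hpow : ∀ (p : Nat.Primes) (k : ℕ) (G : ℝ → ℝ) (C : ℝ), 0 ≤ C →
      (∀ y, 0 < y → |G y| ≤ C * w y) →
      ∀ y, 0 < y → |((1 - dilation p) ^ k) G y| ≤ C * 2 ^ k * w y := by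
    intro p k
    induction k with
    | zero => intro G C _ hG y hy; simpa using hG y hy
    | succ k ih =>
      intro G C hC hG y hy
      rw [pow_succ, Module.End.mul_apply, pow_succ', ← mul_assoc]
      refine ih _ _ (by positivity) (fun y hy => ?_) y hy
      rw [one_sub_dilation_apply]
      have h1 := hdil p G C hC hG y hy
      have h2 : C * (p : ℝ) ^ (-a) * w y ≤ C * w y :=
        mul_le_mul_of_nonneg_right
          (mul_le_of_le_one_right hC (prime_rpow_neg_le_one p ha)) (hw0 y hy)
      have := abs_sub (G y) (G (y / p))
      linarith [hG y hy]
  have hstep : ∀ (p : Nat.Primes) (k : ℕ) (G : ℝ → ℝ) (C : ℝ), 0 ≤ C →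
      (∀ y, 0 < y → |G y| ≤ C * w y) →
      ∀ y, 0 < y → |(1 - (1 - dilation p) ^ k) G y| ≤ C * (2 ^ k * (p : ℝ) ^ (-a)) * w y := by
    intro p k G C hC hG
    have hq : (0 : ℝ) ≤ (p : ℝ) ^ (-a) := by positivity
    -- The constant 2^k - 1 closes the induction: (2^k - 1) + 2^k = 2^(k+1) - 1.
    suffices h : ∀ y, 0 < y →
        |(1 - (1 - dilation p) ^ k) G y| ≤ C * ((2 ^ k - 1) * (p : ℝ) ^ (-a)) * w y by
      intro y hy
      refine (h y hy).trans (mul_le_mul_of_nonneg_right ?_ (hw0 y hy))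
      gcongr
      linarith
    induction k with
    | zero => intro y hy; simp
    | succ k ih =>
      intro y hy
      have e : (1 - (1 - dilation p) ^ (k + 1)) G y =
          (1 - (1 - dilation p) ^ k) G y + ((1 - dilation p) ^ k) G (y / p) := by
        rw [pow_succ']
        change G y - (((1 - dilation p) ^ k) G y - ((1 - dilation p) ^ k) G (y / p)) =
          (G y - ((1 - dilation p) ^ k) G y) + _
        ring
      rw [e]
      have h1 := hdil p _ _ (by positivity) (hpow p k G C hC hG) y hy
      refine (abs_add_le _ _).trans ((add_le_add (ih y hy) h1).trans (le_of_eq ?_))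
      ring
  suffices h : ∀ y, 0 < y → |radicalOperator t l F y| ≤
      (l.map fun p : Nat.Primes => 2 ^ t * (p : ℝ) ^ (-a)).prod * w y from h y hy
  induction l with
  | nil => intro y hy; simpa [radicalOperator] using hF y hy
  | cons p l ih =>
    intro y hy
    have h0 : 0 ≤ (l.map fun p : Nat.Primes => 2 ^ t * (p : ℝ) ^ (-a)).prod :=
      List.prod_nonneg (by
        intro x hx
        obtain ⟨q, _, rfl⟩ := List.mem_map.mp hx
        positivity)
    simp only [radicalOperator, List.map_cons, List.prod_cons, Module.End.mul_apply] at ih ⊢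
    rw [mul_comm (2 ^ t * (p : ℝ) ^ (-a))]
    exact hstep p t _ _ h0 ih y hy

/-! ### Action on the main terms -/

/-- `F x = x P(log x)` for `x > 0`, with a polynomial `P` of degree at most `d` whose coefficient
of degree `d` is `c`. -/
def IsLogPolynomial (d : ℕ) (c : ℝ) (F : ℝ → ℝ) : Prop :=
  ∃ P : Polynomial ℝ, P.natDegree ≤ d ∧ P.coeff d = c ∧
    ∀ x, 0 < x → F x = x * P.eval (Real.log x)

namespace IsLogPolynomial

variable {d : ℕ} {c c' : ℝ} {F G : ℝ → ℝ}

lemma sub (hF : IsLogPolynomial d c F) (hG : IsLogPolynomial d c' G) :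
    IsLogPolynomial d (c - c') (F - G) := by
  obtain ⟨P, hP, hc, h⟩ := hF
  obtain ⟨Q, hQ, hc', h'⟩ := hG
  refine ⟨P - Q, Polynomial.natDegree_sub_le_of_le hP hQ |>.trans (by simp), by simp [hc, hc'], ?_⟩
  intro x hx
  rw [Pi.sub_apply, h x hx, h' x hx, Polynomial.eval_sub, mul_sub]

/-- Since log(x/p) = log x - log p, the polynomial is translated, which keeps its top coefficient;
the outer x contributes 1/p. -/
lemma dilation (hF : IsLogPolynomial d c F) (p : Nat.Primes) :
    IsLogPolynomial d (c * (1 / p)) (dilation p F) := by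
  obtain ⟨P, hP, hc, h⟩ := hF
  have hp : (0 : ℝ) < p := by exact_mod_cast p.2.pos
  refine ⟨Polynomial.C (1 / (p : ℝ)) * Polynomial.taylor (-Real.log p) P, ?_, ?_, ?_⟩
  · exact (Polynomial.natDegree_C_mul_le _ _).trans (by rwa [Polynomial.natDegree_taylor])
  · rw [Polynomial.coeff_C_mul, mul_comm]
    congr 1
    rcases hP.lt_or_eq with hlt | rfl
    · rw [← hc, Polynomial.coeff_eq_zero_of_natDegree_lt hlt,
        Polynomial.coeff_eq_zero_of_natDegree_lt (by rwa [Polynomial.natDegree_taylor])]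
    · rw [← hc, Polynomial.coeff_natDegree, ← Polynomial.leadingCoeff_taylor (-Real.log p),
        Polynomial.leadingCoeff, Polynomial.natDegree_taylor]
  · intro x hx
    rw [dilation_apply, h _ (div_pos hx hp), Real.log_div hx.ne' hp.ne', Polynomial.eval_mul,
      Polynomial.eval_C, Polynomial.taylor_eval]
    rw [← sub_eq_add_neg]
    ring

lemma radicalOperator (hF : IsLogPolynomial d c F) (t : ℕ) (l : List Nat.Primes) :
    IsLogPolynomial d (c * (l.map fun p : Nat.Primes => 1 - (1 - 1 / (p : ℝ)) ^ t).prod)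
      (radicalOperator t l F) := by
  have hpow : ∀ (p : Nat.Primes) (k : ℕ) (c : ℝ) (F : ℝ → ℝ), IsLogPolynomial d c F →
      IsLogPolynomial d (c * (1 - 1 / (p : ℝ)) ^ k) (((1 - _root_.dilation p) ^ k) F) := by
    intro p k
    induction k with
    | zero => intro c F hF; simpa using hF
    | succ k ih =>
      intro c F hF
      rw [pow_succ (1 - _root_.dilation p), Module.End.mul_apply, pow_succ', ← mul_assoc]
      refine ih _ _ ?_
      rw [mul_sub, mul_one]
      exact hF.sub (hF.dilation p)
  induction l with
  | nil => simpa [_root_.radicalOperator] using hF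
  | cons p l ih =>
    simp only [_root_.radicalOperator, List.map_cons, List.prod_cons, Module.End.mul_apply] at ih ⊢
    rw [mul_left_comm, ← mul_comm (c * _), mul_sub, mul_one]
    exact ih.sub (hpow p t _ _ ih)

end IsLogPolynomial

/-! ### Crude growth bounds -/

open ArithmeticFunction in
lemma natCast_zeta_pow {R : Type*} [CommRing R] (t n : ℕ) :
    ((ζ : ArithmeticFunction R) ^ t) n = (((ζ : ArithmeticFunction ℕ) ^ t) n : R) := by
  rw [← natCoe_apply (R := R)]
  congr 1
  induction t with
  | zero => simp
  | succ t ih => rw [pow_succ, ih, pow_succ, natCoe_mul]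

open ArithmeticFunction in
lemma zeta_pow_nonneg (t n : ℕ) : 0 ≤ ((ζ : ArithmeticFunction ℝ) ^ t) n := by
  rw [natCast_zeta_pow]
  positivity

open ArithmeticFunction in
lemma summable_zeta_pow_mul_rpow (t : ℕ) {s : ℝ} (hs : 1 < s) :
    Summable fun n : ℕ => ((ζ : ArithmeticFunction ℝ) ^ t) n * (n : ℝ) ^ (-s) := by
  have h : LSeriesSummable (fun n => ((ζ : ArithmeticFunction ℂ) ^ t) n) s := by
    induction t with
    | zero =>
      refine (summable_of_ne_finset_zero (s := {1}) fun n hn => ?_)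
      have : n ≠ 1 := by simpa using hn
      simp [LSeries.term, one_apply_ne this]
    | succ t ih =>
      rw [pow_succ]
      refine LSeriesSummable_mul ih ?_
      simpa using (LSeriesSummable_zeta_iff (s := (s : ℂ))).mpr (by simpa using hs)
  refine (h.norm).congr fun n => ?_
  rcases eq_or_ne n 0 with rfl | hn
  · simp
  · rw [LSeries.norm_term_eq, if_neg hn, natCast_zeta_pow, natCast_zeta_pow,
      Real.rpow_neg (Nat.cast_nonneg n)]
    simp [div_eq_mul_inv]

-- Rankin's trick: 1 ≤ (x/n)^(1+δ) for n ≤ x, and the Dirichlet series of ζ^t converges at 1 + δ.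
open ArithmeticFunction in
lemma exists_abs_summatory_zeta_pow_le (t : ℕ) {δ : ℝ} (hδ : 0 < δ) :
    ∃ C, 0 ≤ C ∧ ∀ x, 0 < x → |summatory ((ζ : ArithmeticFunction ℝ) ^ t) x| ≤ C * x ^ (1 + δ) := by
  have hs := summable_zeta_pow_mul_rpow t (s := 1 + δ) (by linarith)
  have h0 : ∀ n : ℕ, 0 ≤ ((ζ : ArithmeticFunction ℝ) ^ t) n * (n : ℝ) ^ (-(1 + δ)) := fun n =>
    mul_nonneg (zeta_pow_nonneg t n) (by positivity)
  refine ⟨∑' n : ℕ, ((ζ : ArithmeticFunction ℝ) ^ t) n * (n : ℝ) ^ (-(1 + δ)), tsum_nonneg h0, ?_⟩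
  intro x hx
  rw [summatory_apply, abs_of_nonneg (Finset.sum_nonneg fun n _ => zeta_pow_nonneg t n)]
  refine le_trans ?_ (mul_le_mul_of_nonneg_right
    (hs.sum_le_tsum (Finset.Icc 1 ⌊x⌋₊) fun n _ => h0 n) (by positivity))
  rw [Finset.sum_mul]
  refine Finset.sum_le_sum fun n hn => ?_
  rw [Finset.mem_Icc] at hn
  have hn0 : (0 : ℝ) < n := by exact_mod_cast hn.1
  have hnx : (n : ℝ) ≤ x := (Nat.le_floor_iff hx.le).mp hn.2
  rw [mul_assoc]
  refine le_mul_of_one_le_right (zeta_pow_nonneg t n) ?_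
  rw [Real.rpow_neg hn0.le, ← div_eq_inv_mul, one_le_div (by positivity)]
  exact Real.rpow_le_rpow hn0.le hnx (by linarith)

lemma exists_abs_eval_le_exp (P : Polynomial ℝ) {δ : ℝ} (hδ : 0 < δ) :
    ∃ C, 0 ≤ C ∧ ∀ L, |P.eval L| ≤ C * Real.exp (δ * |L|) := by
  refine ⟨∑ k ∈ Finset.range (P.natDegree + 1), |P.coeff k| * (k.factorial / δ ^ k),
    by positivity, fun L => ?_⟩
  rw [Polynomial.eval_eq_sum_range, Finset.sum_mul]
  refine (Finset.abs_sum_le_sum_abs _ _).trans (Finset.sum_le_sum fun k _ => ?_)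
  rw [abs_mul, abs_pow, mul_assoc]
  refine mul_le_mul_of_nonneg_left ?_ (abs_nonneg _)
  have h := Real.pow_div_factorial_le_exp (x := δ * |L|) (by positivity) k
  rw [mul_pow, div_le_iff₀ (by positivity)] at h
  rw [div_mul_eq_mul_div, le_div_iff₀ (by positivity)]
  linarith

/-- The power x^(1-δ) absorbs the growth of the logarithm as x → 0. -/
lemma exists_abs_mul_eval_log_le (P : Polynomial ℝ) {δ : ℝ} (hδ : 0 < δ) :
    ∃ C, 0 ≤ C ∧ ∀ x, 0 < x →
      |x * P.eval (Real.log x)| ≤ C * (x ^ (1 + δ) + x ^ (1 - δ)) := by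
  obtain ⟨C, hC, h⟩ := exists_abs_eval_le_exp P hδ
  refine ⟨C, hC, fun x hx => ?_⟩
  have h1 : Real.exp (δ * |Real.log x|) ≤ x ^ δ + x ^ (-δ) := by
    rw [Real.rpow_def_of_pos hx, Real.rpow_def_of_pos hx]
    rcases abs_cases (Real.log x) with ⟨e, _⟩ | ⟨e, _⟩ <;> rw [e]
    · rw [mul_comm δ]
      linarith [Real.exp_pos (Real.log x * -δ)]
    · rw [show δ * -Real.log x = Real.log x * -δ by ring]
      linarith [Real.exp_pos (Real.log x * δ)]
  rw [abs_mul, abs_of_pos hx, sub_eq_add_neg, Real.rpow_add hx, Real.rpow_add hx, Real.rpow_one]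
  calc x * |P.eval (Real.log x)| ≤ x * (C * (x ^ δ + x ^ (-δ))) := by
        gcongr
        exact (h _).trans (by gcongr)
    _ = _ := by ring

lemma tendsto_rpow_atTop_zero {a : ℝ} (ha : a < 0) : Tendsto (fun x : ℝ => x ^ a) atTop (nhds 0) := by
  simpa using tendsto_rpow_neg_atTop (y := -a) (by linarith)

lemma rpow_isBigO_rpow {a b : ℝ} (h : a ≤ b) :
    (fun x : ℝ => x ^ a) =O[atTop] fun x : ℝ => x ^ b := by
  refine IsBigO.of_bound 1 ?_
  filter_upwards [eventually_ge_atTop 1] with x hx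
  rw [one_mul, Real.norm_of_nonneg (by positivity), Real.norm_of_nonneg (by positivity)]
  exact Real.rpow_le_rpow_of_exponent_le hx h

lemma mul_eval_log_isBigO (P : Polynomial ℝ) {δ : ℝ} (hδ : 0 < δ) :
    (fun x : ℝ => x * P.eval (Real.log x)) =O[atTop] fun x : ℝ => x ^ (1 + δ) := by
  obtain ⟨C, hC, h⟩ := exists_abs_mul_eval_log_le P hδ
  refine IsBigO.of_bound (2 * C) ?_
  filter_upwards [eventually_ge_atTop 1] with x hx
  rw [Real.norm_of_nonneg (by positivity : 0 ≤ x ^ (1 + δ)), Real.norm_eq_abs]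
  have h1 : x ^ (1 - δ) ≤ x ^ (1 + δ) := Real.rpow_le_rpow_of_exponent_le hx (by linarith)
  refine (h x (by linarith)).trans ?_
  nlinarith

/-! ### The Piltz exponent and its remainder -/

lemma sum_piltzTau_eq_summatory (t : ℕ) (x : ℝ) :
    ∑ n ∈ Finset.Icc 1 ⌊x⌋₊, (piltzTau t n : ℝ) = summatory ((ζ : ArithmeticFunction ℝ) ^ t) x := by
  simp only [piltzTau_eq_zeta_pow, summatory_apply]

lemma isPiltzExponent_one (t : ℕ) : IsPiltzExponent t 1 := by
  have hc : 1 / ((t - 1).factorial : ℝ) ≠ 0 := by positivity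
  refine ⟨Polynomial.C (1 / ((t - 1).factorial : ℝ)) * Polynomial.X ^ (t - 1),
    Polynomial.natDegree_C_mul_X_pow _ _ hc, Polynomial.leadingCoeff_C_mul_X_pow _ _,
    fun ε hε => IsBigO.sub ?_ (mul_eval_log_isBigO _ hε)⟩
  obtain ⟨C, hC, h⟩ := exists_abs_summatory_zeta_pow_le t hε
  refine IsBigO.of_bound C ?_
  filter_upwards [eventually_gt_atTop 0] with x hx
  rw [sum_piltzTau_eq_summatory, Real.norm_of_nonneg (by positivity : 0 ≤ x ^ (1 + ε))]
  exact h x hx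

lemma one_le_piltzTau {t n : ℕ} (ht : 1 ≤ t) (hn : n ≠ 0) : 1 ≤ piltzTau t n := by
  obtain ⟨k, rfl⟩ := Nat.exists_eq_add_of_le' ht
  refine Finset.card_pos.mpr ⟨Fin.cons n fun _ => 1, ?_⟩
  rw [Nat.mem_finMulAntidiag, Fin.prod_univ_succ]
  simp [hn]

/-- The sum jumps by at least 1 at each positive integer while x P(log x) is continuous, so the
remainder cannot tend to 0. -/
lemma IsPiltzExponent.nonneg {t : ℕ} (ht : 1 ≤ t) {θ : ℝ} (h : IsPiltzExponent t θ) : 0 ≤ θ := by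
  by_contra! hθ
  obtain ⟨P, -, -, hP⟩ := h
  have h0 := (hP (-θ / 2) (by linarith)).trans_tendsto (tendsto_rpow_atTop_zero (by linarith))
  have h1 := (Metric.tendsto_atTop.mp h0) (1 / 4) (by norm_num)
  obtain ⟨X, hX⟩ := h1
  simp only [dist_zero_right, Real.norm_eq_abs] at hX
  set n : ℕ := ⌈X⌉₊ + 2 with hn
  have hnX : X + 1 ≤ n := by
    have := Nat.le_ceil X
    rw [hn]; push_cast; linarith
  have hn0 : (0 : ℝ) < n := by positivity
  have hcont : ContinuousAt (fun x : ℝ => x * P.eval (Real.log x)) n := by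
    refine continuousAt_id.mul (P.continuous.continuousAt.comp (Real.continuousAt_log hn0.ne'))
  obtain ⟨η, hη, hcl⟩ := Metric.continuousAt_iff.mp hcont (1 / 4) (by norm_num)
  -- A point just left of n. The remainders at n and x and the change of the main term are each
  -- below 1/4, too little for a jump of 1.
  set x : ℝ := n - min (η / 2) (1 / 2) with hx
  have hm0 : 0 < min (η / 2) (1 / 2) := lt_min (by linarith) (by norm_num)
  have hm1 : min (η / 2) (1 / 2) ≤ 1 / 2 := min_le_right _ _
  have hm2 : min (η / 2) (1 / 2) ≤ η / 2 := min_le_left _ _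
  have hd := hcl (x := x) (by rw [Real.dist_eq, abs_lt]; constructor <;> linarith)
  have hfx : ⌊x⌋₊ = n - 1 := by
    have hn1 : 1 ≤ n := by omega
    rw [Nat.floor_eq_iff (by rw [hx]; have : (2 : ℝ) ≤ n := by rw [hn]; push_cast; linarith [Nat.cast_nonneg (α := ℝ) ⌈X⌉₊]
                             linarith)]
    push_cast [Nat.cast_sub hn1]
    constructor <;> linarith
  have hjump : ∑ k ∈ Finset.Icc 1 ⌊(n : ℝ)⌋₊, (piltzTau t k : ℝ) =
      ∑ k ∈ Finset.Icc 1 ⌊x⌋₊, (piltzTau t k : ℝ) + piltzTau t n := by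
    rw [hfx, Nat.floor_natCast]
    have : n = (n - 1) + 1 := by omega
    conv_lhs => rw [this, Finset.sum_Icc_succ_top (by omega)]
    rw [← this]
  have hτ : (1 : ℝ) ≤ piltzTau t n := by exact_mod_cast one_le_piltzTau ht (by omega)
  have e1 := abs_lt.mp (hX n (by linarith))
  have e2 := abs_lt.mp (hX x (by linarith))
  rw [Real.dist_eq] at hd
  have e3 := abs_lt.mp hd
  rw [hjump] at e1
  linarith [e1.1, e1.2, e2.1, e2.2, e3.1, e3.2]

lemma piltzExponent_nonneg {t : ℕ} (ht : 1 ≤ t) : 0 ≤ piltzExponent t :=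
  Real.sInf_nonneg fun _ h => h.nonneg ht

/-- As a < 1, dividing by x shows that (P - Q)(log x) tends to 0; only the zero polynomial tends to
0 at infinity. -/
lemma eq_of_isBigO_sub_mul_eval_log {f : ℝ → ℝ} {P Q : Polynomial ℝ} {a : ℝ} (ha : a < 1)
    (hP : (fun x : ℝ => f x - x * P.eval (Real.log x)) =O[atTop] fun x : ℝ => x ^ a)
    (hQ : (fun x : ℝ => f x - x * Q.eval (Real.log x)) =O[atTop] fun x : ℝ => x ^ a) : P = Q := by
  have h1 : (fun x : ℝ => x * (P - Q).eval (Real.log x)) =O[atTop] fun x : ℝ => x ^ a := by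
    refine (hQ.sub hP).congr_left fun x => ?_
    rw [Polynomial.eval_sub]
    ring
  have h2 : (fun x : ℝ => (P - Q).eval (Real.log x)) =O[atTop] fun x : ℝ => x ^ (a - 1) := by
    refine ((isBigO_refl (fun x : ℝ => x⁻¹) atTop).mul h1).congr' ?_ ?_
    · filter_upwards [eventually_gt_atTop 0] with x hx
      rw [inv_mul_cancel_left₀ hx.ne']
    · filter_upwards [eventually_gt_atTop 0] with x hx
      rw [Real.rpow_sub hx, Real.rpow_one]
      ring
  have h3 := (h2.trans_tendsto (tendsto_rpow_atTop_zero (by linarith))).comp Real.tendsto_exp_atTop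
  have h4 : Tendsto (fun x => (P - Q).eval x) atTop (nhds 0) := by
    refine h3.congr fun x => ?_
    simp
  have := ((P - Q).tendsto_nhds_iff.mp h4).1
  exact sub_eq_zero.mp (Polynomial.leadingCoeff_eq_zero.mp this)

/-- When the infimum is less than `1`, the polynomial does not depend on the admissible exponent,
and so the infimum is attained. -/
lemma isPiltzExponent_piltzExponent {t : ℕ} (h : piltzExponent t < 1) :
    IsPiltzExponent t (piltzExponent t) := by
  have hne : {θ : ℝ | IsPiltzExponent t θ}.Nonempty := ⟨1, isPiltzExponent_one t⟩
  obtain ⟨θ₀, ⟨P, hd, hl, hP⟩, hθ₀⟩ := exists_lt_of_csInf_lt hne h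
  refine ⟨P, hd, hl, fun ε hε => ?_⟩
  obtain ⟨θ, ⟨P', -, -, hP'⟩, hθ⟩ := exists_lt_of_csInf_lt hne
    (show sInf {θ : ℝ | IsPiltzExponent t θ} < min (piltzExponent t + ε) 1 from
      lt_min (lt_add_of_pos_right _ hε) h)
  have hθ1 : θ < 1 := hθ.trans_le (min_le_right _ _)
  have hθε : θ < piltzExponent t + ε := hθ.trans_le (min_le_left _ _)
  obtain ⟨a, ha, ha1⟩ := exists_between (max_lt hθ₀ hθ1)
  have e : P = P' := by
    refine eq_of_isBigO_sub_mul_eval_log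
      (f := fun x => ∑ n ∈ Finset.Icc 1 ⌊x⌋₊, (piltzTau t n : ℝ)) ha1 ?_ ?_
    · simpa using hP (a - θ₀) (sub_pos.mpr ((le_max_left _ _).trans_lt ha))
    · simpa using hP' (a - θ) (sub_pos.mpr ((le_max_right _ _).trans_lt ha))
  subst e
  simpa using hP' (piltzExponent t + ε - θ) (by linarith)

/-- The remainder in the Piltz divisor problem is bounded by a power on all of `(0, ∞)`. -/
lemma exists_abs_summatory_sub_le {t : ℕ} {P : Polynomial ℝ} {σ : ℝ} (hσ0 : 0 ≤ σ) (hσ : σ < 1)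
    (h : (fun x : ℝ => summatory ((ζ : ArithmeticFunction ℝ) ^ t) x - x * P.eval (Real.log x))
      =O[atTop] fun x : ℝ => x ^ σ) :
    ∃ C, 0 ≤ C ∧ ∀ x, 0 < x →
      |summatory ((ζ : ArithmeticFunction ℝ) ^ t) x - x * P.eval (Real.log x)| ≤ C * x ^ σ := by
  obtain ⟨C₁, hC₁⟩ := h.bound
  obtain ⟨X, hX⟩ := eventually_atTop.mp hC₁
  -- With δ = 1 - σ, the power x^(1-δ) is exactly x^σ, and x^(1+δ) costs at most Y^2 x^σ for x ≤ Y.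
  obtain ⟨C₂, hC₂, h₂⟩ := exists_abs_mul_eval_log_le P (δ := 1 - σ) (by linarith)
  obtain ⟨C₃, hC₃, h₃⟩ := exists_abs_summatory_zeta_pow_le t (δ := 1 - σ) (by linarith)
  set Y := max X 1
  have hY : 1 ≤ Y := le_max_right _ _
  refine ⟨max C₁ ((C₂ + C₃) * Y ^ (2 : ℝ) + C₂), le_max_of_le_right (by positivity),
    fun x hx => ?_⟩
  rcases le_total Y x with hx1 | hx1
  · have := hX x ((le_max_left _ _).trans hx1)
    rw [Real.norm_eq_abs, Real.norm_of_nonneg (by positivity : 0 ≤ x ^ σ)] at this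
    exact this.trans (by gcongr; exact le_max_left _ _)
  · have e1 : x ^ (1 + (1 - σ)) ≤ Y ^ (2 : ℝ) * x ^ σ := by
      rw [show 1 + (1 - σ) = (2 - 2 * σ) + σ by ring, Real.rpow_add hx]
      gcongr
      exact (Real.rpow_le_rpow hx.le hx1 (by linarith)).trans
        (Real.rpow_le_rpow_of_exponent_le hY (by linarith))
    have e2 : x ^ (1 - (1 - σ)) = x ^ σ := by congr 1; ring
    have a1 := h₂ x hx
    have a2 := h₃ x hx
    rw [e2] at a1
    calc _ ≤ C₃ * x ^ (1 + (1 - σ)) + C₂ * (x ^ (1 + (1 - σ)) + x ^ σ) :=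
          (abs_sub _ _).trans (add_le_add a2 a1)
      _ ≤ C₃ * (Y ^ (2 : ℝ) * x ^ σ) + C₂ * (Y ^ (2 : ℝ) * x ^ σ + x ^ σ) := by gcongr
      _ = ((C₂ + C₃) * Y ^ (2 : ℝ) + C₂) * x ^ σ := by ring
      _ ≤ _ := by gcongr; exact le_max_right _ _

/-! ### Series of polynomials of bounded degree -/

/-- By Lagrange interpolation each coefficient is a fixed linear combination of the values at 0, …,
n, so summability of values passes to coefficients. -/
lemma exists_polynomial_hasSum {ι : Type*} (f : ι → Polynomial ℝ) (n : ℕ)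
    (hdeg : ∀ s, (f s).natDegree ≤ n)
    (hf : ∀ j : ℕ, Summable fun s => (f s).eval (j : ℝ)) :
    ∃ Q : Polynomial ℝ, Q.natDegree ≤ n ∧ (∀ k, HasSum (fun s => (f s).coeff k) (Q.coeff k)) ∧
      ∀ L : ℝ, HasSum (fun s => (f s).eval L) (Q.eval L) := by
  have hcoeff : ∀ k, Summable fun s => (f s).coeff k := by
    intro k
    have h : ∀ s, (f s).coeff k = ∑ j ∈ Finset.range (n + 1), (f s).eval (j : ℝ) *
        (Lagrange.basis (Finset.range (n + 1)) (fun j : ℕ => (j : ℝ)) j).coeff k := by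
      intro s
      have hinj : Set.InjOn (fun j : ℕ => (j : ℝ)) (Finset.range (n + 1)) :=
        Nat.cast_injective.injOn
      have := Lagrange.eq_interpolate (f := f s) hinj (by
        rw [Finset.card_range]
        exact Polynomial.degree_le_natDegree.trans_lt (by exact_mod_cast Nat.lt_succ_of_le (hdeg s)))
      conv_lhs => rw [this]
      simp only [Lagrange.interpolate_apply, Polynomial.finsetSum_coeff, Polynomial.coeff_C_mul]
    simp only [h]
    exact summable_sum fun j _ => (hf j).mul_right _
  have hz : ∀ k, n < k → ∀ s, (f s).coeff k = 0 := fun k hk s =>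
    Polynomial.coeff_eq_zero_of_natDegree_lt ((hdeg s).trans_lt hk)
  set Q : Polynomial ℝ :=
    ∑ k ∈ Finset.range (n + 1), Polynomial.C (∑' s, (f s).coeff k) * Polynomial.X ^ k with hQ
  have hQc : ∀ k, Q.coeff k = ∑' s, (f s).coeff k := by
    intro k
    simp only [hQ, Polynomial.finsetSum_coeff, Polynomial.coeff_C_mul_X_pow]
    rw [Finset.sum_ite_eq]
    split_ifs with h
    · rfl
    · rw [Finset.mem_range] at h
      simp [hz k (by omega)]
  refine ⟨Q, ?_, fun k => hQc k ▸ (hcoeff k).hasSum, fun L => ?_⟩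
  · rw [Polynomial.natDegree_le_iff_coeff_eq_zero]
    intro k hk
    simp [hQc, hz k hk]
  · have he : ∀ s, (f s).eval L = ∑ k ∈ Finset.range (n + 1), (f s).coeff k * L ^ k := fun s =>
      Polynomial.eval_eq_sum_range' (Nat.lt_succ_of_le (hdeg s)) L
    simp only [he, hQ, Polynomial.eval_finsetSum, Polynomial.eval_mul, Polynomial.eval_C,
      Polynomial.eval_pow, Polynomial.eval_X]
    exact hasSum_sum fun k _ => (hcoeff k).hasSum.mul_right _

/-! ### The Euler product Δ -/

/-- `deltaFactor t p - 1`. -/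
noncomputable def deltaTerm {r : ℕ} (t : Fin r → ℕ) (p : ℕ) : ℝ :=
  -∏ i, (1 - (1 - 1 / (p : ℝ)) ^ t i)

/-- The sum over the box factorises; the binomial theorem without its term a = 0 evaluates each
factor, and (-1)^(r-1) (-1)^r = -1. -/
lemma deltaFactor_eq {r : ℕ} (hr : 0 < r) (t : Fin r → ℕ) (p : ℕ) :
    deltaFactor t p = 1 + deltaTerm t p := by
  have h1 : ∀ m : ℕ, ∑ a ∈ Finset.Icc 1 m, (1 / (p : ℝ)) ^ a * ((-1) ^ a * (m.choose a : ℝ)) =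
      -(1 - (1 - 1 / (p : ℝ)) ^ m) := by
    intro m
    have : 1 - 1 / (p : ℝ) = -(1 / (p : ℝ)) + 1 := by ring
    rw [this, add_pow, Finset.range_eq_Ico, Finset.sum_eq_sum_Ico_succ_bot (by omega)]
    simp only [pow_zero, one_pow, Nat.choose_zero_right, Nat.cast_one, mul_one, zero_add]
    rw [sub_add_cancel_left, neg_neg]
    refine Finset.sum_congr (by ext; simp) fun a _ => ?_
    rw [neg_pow (1 / (p : ℝ))]
    ring
  have h2 : ∑ a ∈ Fintype.piFinset (fun i : Fin r => Finset.Icc 1 (t i)),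
      (1 / (p : ℝ) ^ (∑ i, a i)) * ∏ i, ((-1) ^ (a i) * ((t i).choose (a i) : ℝ)) =
      ∏ i, -(1 - (1 - 1 / (p : ℝ)) ^ t i) := by
    simp only [← h1]
    rw [Finset.prod_univ_sum]
    refine Finset.sum_congr rfl fun a _ => ?_
    rw [← one_div_pow, ← Finset.prod_pow_eq_pow_sum, ← Finset.prod_mul_distrib]
  rw [deltaFactor, h2, deltaTerm, Finset.prod_neg, Finset.card_univ, Fintype.card_fin, ← mul_assoc,
    ← pow_add, Odd.neg_one_pow ⟨r - 1, by omega⟩, neg_one_mul]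

lemma one_sub_pow_bounds (p : Nat.Primes) (t : ℕ) :
    0 ≤ 1 - (1 - 1 / (p : ℝ)) ^ t ∧ 1 - (1 - 1 / (p : ℝ)) ^ t < 1 ∧
      1 - (1 - 1 / (p : ℝ)) ^ t ≤ t * (1 / (p : ℝ)) := by
  have hp : (1 : ℝ) < p := by exact_mod_cast p.2.one_lt
  have h1 : 1 / (p : ℝ) < 1 := by rw [div_lt_one (by linarith)]; exact hp
  have h0 : 0 < 1 / (p : ℝ) := by positivity
  refine ⟨sub_nonneg.mpr (pow_le_one₀ (by linarith) (by linarith)),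
    sub_lt_self _ (pow_pos (by linarith) _), ?_⟩
  have := one_add_mul_le_pow (a := -(1 / (p : ℝ))) (by linarith) t
  rw [← sub_eq_add_neg] at this
  linarith

lemma summable_norm_deltaTerm {r : ℕ} (hr : 2 ≤ r) (t : Fin r → ℕ) :
    Summable fun p : Nat.Primes => ‖deltaTerm t p‖ := by
  have h : Summable fun p : Nat.Primes => (∏ i, (t i : ℝ)) * (p : ℝ) ^ (-(r : ℝ)) := by
    refine (Nat.Primes.summable_rpow.mpr ?_).mul_left _
    have : (2 : ℝ) ≤ r := by exact_mod_cast hr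
    linarith
  refine h.of_nonneg_of_le (fun _ => norm_nonneg _) fun p => ?_
  rw [deltaTerm, norm_neg, Real.norm_of_nonneg
    (Finset.prod_nonneg fun i _ => (one_sub_pow_bounds p (t i)).1)]
  refine (Finset.prod_le_prod (fun i _ => (one_sub_pow_bounds p (t i)).1)
    fun i _ => (one_sub_pow_bounds p (t i)).2.2).trans (le_of_eq ?_)
  rw [Finset.prod_mul_distrib, Finset.prod_const, Finset.card_univ, Fintype.card_fin,
    Real.rpow_neg (Nat.cast_nonneg _), Real.rpow_natCast, one_div, inv_pow]

lemma deltaOne_eq_tprod {r : ℕ} (hr : 0 < r) (t : Fin r → ℕ) :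
    deltaOne t = ∏' p : Nat.Primes, (1 + deltaTerm t p) := by
  simp only [deltaOne, deltaFactor_eq hr]

/-- Every factor is positive and the product converges absolutely. Nonvanishing gives Q its exact
degree. -/
lemma deltaOne_ne_zero {r : ℕ} (hr : 2 ≤ r) (t : Fin r → ℕ) : deltaOne t ≠ 0 := by
  rw [deltaOne_eq_tprod (by omega)]
  refine tprod_one_add_ne_zero_of_summable (fun p => ?_) (summable_norm_deltaTerm hr t)
  rw [deltaTerm, ← sub_eq_add_neg]
  refine (sub_pos.mpr ?_).ne'
  have hi : (⟨0, by omega⟩ : Fin r) ∈ Finset.univ := Finset.mem_univ _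
  rw [← Finset.mul_prod_erase _ _ hi]
  exact mul_lt_one_of_nonneg_of_lt_one_left (one_sub_pow_bounds p _).1 (one_sub_pow_bounds p _).2.1
    (Finset.prod_le_one (fun i _ => (one_sub_pow_bounds p (t i)).1)
      fun i _ => (one_sub_pow_bounds p (t i)).2.1.le)

lemma hasSum_prod_deltaTerm {r : ℕ} (hr : 2 ≤ r) (t : Fin r → ℕ) :
    HasSum (fun s : Finset Nat.Primes => ∏ p ∈ s, deltaTerm t p) (deltaOne t) := by
  have h := summable_finsetProd_of_summable_norm (summable_norm_deltaTerm hr t)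
  rw [deltaOne_eq_tprod (by omega), tprod_one_add h]
  exact h.hasSum

/-! ### Summable bounds for products over i -/

lemma summable_prod_mul_rpow (K : ℝ) {β : ℝ} (hβ : 1 < β) :
    Summable fun s : Finset Nat.Primes => ∏ p ∈ s, (K * (p : ℝ) ^ (-β)) := by
  refine summable_finsetProd_of_summable_norm (f := fun p : Nat.Primes => K * (p : ℝ) ^ (-β)) ?_
  simp only [norm_mul]
  refine (Summable.congr (Nat.Primes.summable_rpow.mpr (neg_lt_neg hβ)) fun p => ?_).mul_left _
  rw [Real.norm_of_nonneg (by positivity)]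

lemma abs_prod_sub_prod_le {r : ℕ} {b m : Fin r → ℝ} {B e : ℝ} (hb : ∀ i, |b i| ≤ B)
    (hm : ∀ i, |m i| ≤ B) (he : ∀ i, |b i - m i| ≤ e) :
    |∏ i, b i - ∏ i, m i| ≤ r * (e * B ^ (r - 1)) := by
  induction r with
  | zero => simp
  | succ r ih =>
    have hB : 0 ≤ B := (abs_nonneg _).trans (hb 0)
    have he0 : 0 ≤ e := (abs_nonneg _).trans (he 0)
    have h := ih (fun i => hb i.succ) (fun i => hm i.succ) (fun i => he i.succ)
    rw [Fin.prod_univ_succ, Fin.prod_univ_succ]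
    have e1 : b 0 * ∏ i : Fin r, b i.succ - m 0 * ∏ i : Fin r, m i.succ =
        (b 0 - m 0) * ∏ i : Fin r, b i.succ +
          m 0 * (∏ i : Fin r, b i.succ - ∏ i : Fin r, m i.succ) := by ring
    have h1 : |∏ i : Fin r, b i.succ| ≤ B ^ r := by
      rw [Finset.abs_prod]
      refine (Finset.prod_le_prod (fun i _ => abs_nonneg _) fun i _ => hb i.succ).trans ?_
      simp
    -- At r = 0 the truncated exponent r - 1 is harmless because the factor r vanishes.
    have h2 : B * (r * (e * B ^ (r - 1))) ≤ r * (e * B ^ r) := by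
      rcases r with _ | r
      · simp
      · simp only [Nat.add_sub_cancel, pow_succ]
        exact le_of_eq (by ring)
    rw [e1]
    refine (abs_add_le _ _).trans ?_
    rw [abs_mul, abs_mul]
    have h3 := mul_le_mul (he 0) h1 (abs_nonneg _) he0
    have h4 := mul_le_mul (hm 0) h (abs_nonneg _) hB
    rw [Nat.add_sub_cancel]
    push_cast
    linarith

lemma abs_radicalOperator_finset_le {t T : ℕ} (htT : t ≤ T) {w : ℝ → ℝ} {a : ℝ} (ha : 0 ≤ a)
    (hw0 : ∀ y, 0 < y → 0 ≤ w y)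
    (hw : ∀ (p : Nat.Primes) (y : ℝ), 0 < y → w (y / p) ≤ (p : ℝ) ^ (-a) * w y)
    {F : ℝ → ℝ} (hF : ∀ y, 0 < y → |F y| ≤ w y) (s : Finset Nat.Primes) {y : ℝ} (hy : 0 < y) :
    |radicalOperator t s.toList F y| ≤ (∏ p ∈ s, (2 ^ T * (p : ℝ) ^ (-a))) * w y := by
  refine (abs_radicalOperator_le t ha hw0 hw hF s.toList y hy).trans ?_
  rw [Finset.prod_map_toList]
  refine mul_le_mul_of_nonneg_right ?_ (hw0 y hy)
  gcongr
  norm_num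

/-- The weight `y ^ (1 + δ) + y ^ (1 - δ)`. -/
noncomputable def nearLinear (δ y : ℝ) : ℝ := y ^ (1 + δ) + y ^ (1 - δ)

lemma nearLinear_nonneg (δ : ℝ) {y : ℝ} (hy : 0 < y) : 0 ≤ nearLinear δ y := by
  unfold nearLinear
  positivity

lemma nearLinear_le {δ x : ℝ} (hδ : 0 ≤ δ) (hx : 1 ≤ x) : nearLinear δ x ≤ 2 * x ^ (1 + δ) := by
  have : x ^ (1 - δ) ≤ x ^ (1 + δ) := Real.rpow_le_rpow_of_exponent_le hx (by linarith)
  unfold nearLinear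
  linarith

lemma div_rpow_prime (p : Nat.Primes) (a : ℝ) {y : ℝ} (hy : 0 < y) :
    (y / p) ^ a = (p : ℝ) ^ (-a) * y ^ a := by
  rw [Real.div_rpow hy.le (Nat.cast_nonneg _), Real.rpow_neg (Nat.cast_nonneg _), div_eq_inv_mul]

lemma nearLinear_div_le {δ : ℝ} (hδ : 0 ≤ δ) (p : Nat.Primes) {y : ℝ} (hy : 0 < y) :
    nearLinear δ (y / p) ≤ (p : ℝ) ^ (-(1 - δ)) * nearLinear δ y := by
  unfold nearLinear
  rw [div_rpow_prime p _ hy, div_rpow_prime p _ hy, mul_add]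
  have hp : (1 : ℝ) ≤ p := by exact_mod_cast p.2.one_le
  gcongr
  · linarith

section

variable {r : ℕ} {t : Fin r → ℕ} {F G : Fin r → ℝ → ℝ} {C δ : ℝ}

lemma abs_radicalOperator_nearLinear_le (hC : 0 ≤ C) (hδ0 : 0 ≤ δ) (hδ : δ ≤ 1)
    (hF : ∀ i y, 0 < y → |F i y| ≤ C * nearLinear δ y) (i : Fin r) (s : Finset Nat.Primes) {x : ℝ}
    (hx : 1 ≤ x) :
    |radicalOperator (t i) s.toList (F i) x| ≤
      (∏ p ∈ s, (2 ^ (∑ i, t i) * (p : ℝ) ^ (-(1 - δ)))) * (2 * C) * x ^ (1 + δ) := by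
  refine (abs_radicalOperator_finset_le (Finset.single_le_sum (fun _ _ => Nat.zero_le _)
    (Finset.mem_univ i)) (sub_nonneg.mpr hδ) (w := fun y => C * nearLinear δ y)
    (fun y hy => mul_nonneg hC (nearLinear_nonneg δ hy)) (fun p y hy => ?_) (hF i) s
    (by linarith)).trans ?_
  · rw [mul_left_comm]
    exact mul_le_mul_of_nonneg_left (nearLinear_div_le hδ0 p hy) hC
  · rw [mul_assoc]
    refine mul_le_mul_of_nonneg_left ?_ (by positivity)
    linarith [mul_le_mul_of_nonneg_left (nearLinear_le hδ0 hx) hC]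

lemma summable_norm_prod_radicalOperator (hC : 0 ≤ C) (hδ0 : 0 ≤ δ) (hδ : δ ≤ 1)
    (hr : 1 < r * (1 - δ)) (hF : ∀ i y, 0 < y → |F i y| ≤ C * nearLinear δ y) {x : ℝ}
    (hx : 1 ≤ x) :
    Summable fun s : Finset Nat.Primes => ‖∏ i, radicalOperator (t i) s.toList (F i) x‖ := by
  refine ((summable_prod_mul_rpow ((2 ^ (∑ i, t i)) ^ r) hr).mul_right
    ((2 * C * x ^ (1 + δ)) ^ r)).of_nonneg_of_le (fun _ => norm_nonneg _) fun s => ?_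
  rw [norm_prod]
  refine (Finset.prod_le_prod (fun _ _ => norm_nonneg _) fun i _ =>
    abs_radicalOperator_nearLinear_le hC hδ0 hδ hF i s hx).trans (le_of_eq ?_)
  rw [Finset.prod_const, Finset.card_univ, Fintype.card_fin, mul_assoc, mul_pow,
    ← Finset.prod_pow]
  congr 1
  refine Finset.prod_congr rfl fun p _ => ?_
  rw [mul_pow, ← Real.rpow_mul_natCast (Nat.cast_nonneg _)]
  congr 2
  ring

/-- Replacing the factors one at a time, one factor carries F - G and decays like p^(-σ), while r -
1 factors decay like p^(-(1-δ)); `hr` makes their product summable over s. -/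
lemma exists_summable_bound_prod_sub_prod {σ : ℝ} (hC : 0 ≤ C) (hδ0 : 0 ≤ δ) (hδ : δ ≤ 1)
    (hσ : 0 ≤ σ) (hr0 : 1 ≤ r) (hr : 1 < σ + (r - 1) * (1 - δ))
    (hF : ∀ i y, 0 < y → |F i y| ≤ C * nearLinear δ y)
    (hG : ∀ i y, 0 < y → |G i y| ≤ C * nearLinear δ y)
    (hFG : ∀ i y, 0 < y → |F i y - G i y| ≤ C * y ^ σ) :
    ∃ g : Finset Nat.Primes → ℝ, Summable g ∧ ∀ s x, 1 ≤ x →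
      |∏ i, radicalOperator (t i) s.toList (F i) x - ∏ i, radicalOperator (t i) s.toList (G i) x| ≤
        g s * x ^ (σ + (r - 1) * (1 + δ)) := by
  refine ⟨_, (summable_prod_mul_rpow ((2 ^ (∑ i, t i)) ^ r) hr).mul_right
    (r * (C * (2 * C) ^ (r - 1))), fun s x hx => ?_⟩
  have hx0 : 0 < x := by linarith
  refine (abs_prod_sub_prod_le
    (fun i => abs_radicalOperator_nearLinear_le hC hδ0 hδ hF i s hx)
    (fun i => abs_radicalOperator_nearLinear_le hC hδ0 hδ hG i s hx)
    (e := (∏ p ∈ s, (2 ^ (∑ i, t i) * (p : ℝ) ^ (-σ))) * (C * x ^ σ)) fun i => ?_).trans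
    (le_of_eq ?_)
  · rw [← Pi.sub_apply (radicalOperator (t i) s.toList (F i)), ← map_sub]
    refine abs_radicalOperator_finset_le (Finset.single_le_sum (fun _ _ => Nat.zero_le _)
      (Finset.mem_univ i)) hσ (w := fun y => C * y ^ σ) (fun y hy => by positivity)
      (fun p y hy => ?_) (hFG i) s hx0
    rw [div_rpow_prime p _ hy]
    exact le_of_eq (by ring)
  · have hcast : ((r - 1 : ℕ) : ℝ) = r - 1 := by rw [Nat.cast_sub hr0, Nat.cast_one]
    have h1 : ∏ p ∈ s, (((2 : ℝ) ^ (∑ i, t i)) ^ r * (p : ℝ) ^ (-(σ + (r - 1) * (1 - δ)))) =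
        (∏ p ∈ s, (2 ^ (∑ i, t i) * (p : ℝ) ^ (-σ))) *
          (∏ p ∈ s, (2 ^ (∑ i, t i) * (p : ℝ) ^ (-(1 - δ)))) ^ (r - 1) := by
      rw [← Finset.prod_pow, ← Finset.prod_mul_distrib]
      refine Finset.prod_congr rfl fun p _ => ?_
      have hp : (0 : ℝ) < p := by exact_mod_cast p.2.pos
      rw [mul_pow, ← Real.rpow_mul_natCast hp.le, mul_mul_mul_comm, ← Real.rpow_add hp, hcast,
        ← pow_succ', Nat.sub_add_cancel hr0]
      congr 2
      ring
    have h2 : x ^ (σ + (r - 1) * (1 + δ)) = x ^ σ * (x ^ (1 + δ)) ^ (r - 1) := by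
      rw [Real.rpow_add hx0, ← Real.rpow_mul_natCast hx0.le, hcast, mul_comm (1 + δ)]
    rw [h1, h2, mul_pow, mul_pow]
    ring

end

/-! ### Assembly of the asymptotic formula -/

lemma rpow_le_nearLinear (δ : ℝ) {y : ℝ} (hy : 0 < y) : y ^ (1 + δ) ≤ nearLinear δ y := by
  have : 0 ≤ y ^ (1 - δ) := by positivity
  unfold nearLinear
  linarith

lemma coprimeTauSum_isBigO {r : ℕ} (t : Fin r → ℕ) {ε : ℝ} (hε : 0 < ε) :
    coprimeTauSum t =O[atTop] fun x : ℝ => x ^ ((r : ℝ) + ε) := by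
  have hδ : 0 < ε / (r + 1) := by positivity
  choose C hC0 hC using fun i => exists_abs_summatory_zeta_pow_le (t i) hδ
  refine IsBigO.of_bound (∏ i, C i) ?_
  filter_upwards [eventually_ge_atTop 1] with x hx
  have hx0 : 0 < x := by linarith
  have h0 : ∀ n : Fin r → ℕ, (0 : ℝ) ≤ ∏ i, (piltzTau (t i) (n i) : ℝ) := fun n =>
    Finset.prod_nonneg fun i _ => Nat.cast_nonneg _
  rw [Real.norm_of_nonneg (by positivity : 0 ≤ x ^ ((r : ℝ) + ε)), coprimeTauSum,
    Real.norm_of_nonneg (Finset.sum_nonneg fun n _ => h0 n)]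
  calc _ ≤ ∑ n ∈ Fintype.piFinset (fun _ : Fin r => Finset.Icc 1 ⌊x⌋₊),
        ∏ i, (piltzTau (t i) (n i) : ℝ) :=
        Finset.sum_le_sum_of_subset_of_nonneg (Finset.filter_subset _ _) fun n _ _ => h0 n
    _ = ∏ i, ∑ m ∈ Finset.Icc 1 ⌊x⌋₊, (piltzTau (t i) m : ℝ) :=
        (Finset.prod_univ_sum (fun _ => Finset.Icc 1 ⌊x⌋₊)
          fun i m => (piltzTau (t i) m : ℝ)).symm
    _ ≤ ∏ i, (C i * x ^ (1 + ε / (r + 1))) := by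
        refine Finset.prod_le_prod (fun i _ => by positivity) fun i _ => ?_
        rw [sum_piltzTau_eq_summatory]
        exact (le_abs_self _).trans (hC i x hx0)
    _ ≤ (∏ i, C i) * x ^ ((r : ℝ) + ε) := by
        rw [Finset.prod_mul_distrib, Finset.prod_const, Finset.card_univ, Fintype.card_fin,
          ← Real.rpow_mul_natCast hx0.le]
        refine mul_le_mul_of_nonneg_left (Real.rpow_le_rpow_of_exponent_le hx ?_)
          (Finset.prod_nonneg fun i _ => hC0 i)
        have : ε / (r + 1) * r ≤ ε := by
          rw [div_mul_eq_mul_div, div_le_iff₀ (by positivity)]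
          nlinarith
        linarith

lemma pow_mul_eval_log_isBigO {r : ℕ} (hr : 1 ≤ r) (Q : Polynomial ℝ) {ε : ℝ} (hε : 0 < ε) :
    (fun x : ℝ => x ^ r * Q.eval (Real.log x)) =O[atTop] fun x : ℝ => x ^ ((r : ℝ) + ε) := by
  refine ((isBigO_refl (fun x : ℝ => x ^ (r - 1)) atTop).mul (mul_eval_log_isBigO Q hε)).congr' ?_ ?_
  · refine Eventually.of_forall fun x => ?_
    change x ^ (r - 1) * (x * _) = _
    rw [← mul_assoc, ← pow_succ, Nat.sub_add_cancel hr]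
  · filter_upwards [eventually_gt_atTop 0] with x hx
    rw [← Real.rpow_natCast, ← Real.rpow_add hx, Nat.cast_sub hr]
    congr 1
    push_cast
    ring

lemma exists_uniform_bound {r : ℕ} {F : Fin r → ℝ → ℝ} {w : ℝ → ℝ} (hw : ∀ x, 0 < x → 0 ≤ w x)
    (h : ∀ i, ∃ C, 0 ≤ C ∧ ∀ x, 0 < x → |F i x| ≤ C * w x) :
    ∃ C, 0 ≤ C ∧ ∀ i x, 0 < x → |F i x| ≤ C * w x := by
  choose C hC0 hC using h
  refine ⟨∑ i, C i, Finset.sum_nonneg fun i _ => hC0 i, fun i x hx => (hC i x hx).trans ?_⟩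
  exact mul_le_mul_of_nonneg_right
    (Finset.single_le_sum (fun j _ => hC0 j) (Finset.mem_univ i)) (hw x hx)

lemma coeff_prod_sum_of_natDegree_le {ι : Type*} (s : Finset ι) (f : ι → Polynomial ℝ) (d : ι → ℕ)
    (h : ∀ i ∈ s, (f i).natDegree ≤ d i) :
    (∏ i ∈ s, f i).coeff (∑ i ∈ s, d i) = ∏ i ∈ s, (f i).coeff (d i) := by
  classical
  induction s using Finset.induction_on with
  | empty => simp
  | insert a s ha ih =>
    have h' : ∀ i ∈ s, (f i).natDegree ≤ d i := fun i hi => h i (Finset.mem_insert_of_mem hi)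
    rw [Finset.prod_insert ha, Finset.sum_insert ha, Finset.prod_insert ha,
      Polynomial.coeff_mul_add_eq_of_natDegree_le (h a (Finset.mem_insert_self _ _))
        ((Polynomial.natDegree_prod_le _ _).trans (Finset.sum_le_sum h')), ih h']

/-- The main terms of the inclusion–exclusion sum add up to `x ^ r Q(log x)`. -/
lemma exists_polynomial_hasSum_prod_radicalOperator {r : ℕ} (hr : 2 ≤ r) (t : Fin r → ℕ)
    (P : Fin r → Polynomial ℝ) (d : Fin r → ℕ) (hP : ∀ i, (P i).natDegree ≤ d i) :
    ∃ Q : Polynomial ℝ, Q.natDegree ≤ ∑ i, d i ∧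
      Q.coeff (∑ i, d i) = deltaOne t * ∏ i, (P i).coeff (d i) ∧
      ∀ x : ℝ, 1 ≤ x → HasSum (fun s : Finset Nat.Primes => (-1) ^ s.card *
        ∏ i, radicalOperator (t i) s.toList (fun x => x * (P i).eval (Real.log x)) x)
        (x ^ r * Q.eval (Real.log x)) := by
  have hr' : (2 : ℝ) ≤ r := by exact_mod_cast hr
  have hlog : ∀ i (s : Finset Nat.Primes), IsLogPolynomial (d i)
      ((P i).coeff (d i) * ∏ p ∈ s, (1 - (1 - 1 / (p : ℝ)) ^ t i))
      (radicalOperator (t i) s.toList (fun x => x * (P i).eval (Real.log x))) := by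
    intro i s
    rw [← Finset.prod_map_toList]
    exact IsLogPolynomial.radicalOperator ⟨P i, hP i, rfl, fun _ _ => rfl⟩ _ _
  choose N hNd hNc hN using hlog
  set f : Finset Nat.Primes → Polynomial ℝ := fun s => Polynomial.C ((-1) ^ s.card) * ∏ i, N i s
    with hf
  have hfd : ∀ s, (f s).natDegree ≤ ∑ i, d i := fun s =>
    (Polynomial.natDegree_C_mul_le _ _).trans
      ((Polynomial.natDegree_prod_le _ _).trans (Finset.sum_le_sum fun i _ => hNd i s))
  have hfe : ∀ s x, 0 < x → (-1) ^ s.card *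
      ∏ i, radicalOperator (t i) s.toList (fun x => x * (P i).eval (Real.log x)) x =
      x ^ r * (f s).eval (Real.log x) := by
    intro s x hx
    simp only [hf, hN _ s x hx, Polynomial.eval_mul, Polynomial.eval_C, Polynomial.eval_prod]
    rw [Finset.prod_mul_distrib, Finset.prod_const, Finset.card_univ, Fintype.card_fin]
    ring
  obtain ⟨C, hC, hB⟩ := exists_uniform_bound
    (F := fun i x => x * (P i).eval (Real.log x)) (fun x hx => nearLinear_nonneg (1 / 4) hx)
    fun i => exists_abs_mul_eval_log_le (P i) (by norm_num)
  have hsum : ∀ j : ℕ, Summable fun s => (f s).eval (j : ℝ) := by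
    intro j
    -- Taking x = e^j makes log x = j, an interpolation node.
    have hx : 1 ≤ Real.exp j := Real.one_le_exp (Nat.cast_nonneg j)
    have h := summable_norm_prod_radicalOperator (t := t) hC (by norm_num) (by norm_num)
      (by linarith) hB hx
    refine ((h.mul_left (Real.exp j ^ r)⁻¹)).of_norm_bounded fun s => ?_
    have h1 := hfe s _ (Real.exp_pos j)
    rw [Real.log_exp] at h1
    have h2 : (f s).eval (j : ℝ) = (Real.exp j ^ r)⁻¹ * ((-1) ^ s.card *
        ∏ i, radicalOperator (t i) s.toList (fun x => x * (P i).eval (Real.log x)) (Real.exp j)) := by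
      rw [h1, inv_mul_cancel_left₀ (by positivity)]
    rw [h2, norm_mul, norm_mul, norm_pow, norm_neg, norm_one, one_pow, one_mul,
      Real.norm_of_nonneg (by positivity : 0 ≤ (Real.exp j ^ r)⁻¹)]
  obtain ⟨Q, hQd, hQc, hQ⟩ := exists_polynomial_hasSum f _ hfd hsum
  refine ⟨Q, hQd, (hQc _).unique ?_, fun x hx => ?_⟩
  · refine ((hasSum_prod_deltaTerm hr t).mul_right _).congr_fun fun s => ?_
    rw [hf, Polynomial.coeff_C_mul, coeff_prod_sum_of_natDegree_le _ _ _ fun i _ => hNd i s]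
    simp only [hNc, deltaTerm]
    rw [Finset.prod_neg, Finset.prod_mul_distrib, Finset.prod_comm]
    ring
  · simp only [hfe _ x (by linarith : 0 < x)]
    exact (hQ _).mul_left _

/-- The asymptotic formula when every exponent in the Piltz divisor problem is less than `1`. -/
lemma exists_polynomial_of_piltzExponent_lt_one {r : ℕ} (hr : 2 ≤ r) {t : Fin r → ℕ} {Θ : ℝ}
    (hΘ0 : 0 ≤ Θ) (hΘ1 : Θ < 1) (hΘ : ∀ i, piltzExponent (t i) ≤ Θ) :
    ∃ Q : Polynomial ℝ, Q.natDegree ≤ ∑ i, (t i - 1) ∧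
      Q.coeff (∑ i, (t i - 1)) = deltaOne t * ∏ i, (1 / ((t i - 1).factorial : ℝ)) ∧
      ∀ ε : ℝ, 0 < ε → (fun x : ℝ => coprimeTauSum t x - x ^ r * Q.eval (Real.log x))
        =O[atTop] fun x : ℝ => x ^ ((r : ℝ) - 1 + Θ + ε) := by
  have hr' : (2 : ℝ) ≤ r := by exact_mod_cast hr
  choose P hPd hPl hP using fun i => isPiltzExponent_piltzExponent ((hΘ i).trans_lt hΘ1)
  obtain ⟨Q, hQd, hQc, hQ⟩ := exists_polynomial_hasSum_prod_radicalOperator hr t P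
    (fun i => t i - 1) fun i => (hPd i).le
  refine ⟨Q, hQd, ?_, fun ε hε => ?_⟩
  · rw [hQc]
    congr 1
    refine Finset.prod_congr rfl fun i _ => ?_
    rw [← hPl i, Polynomial.leadingCoeff, hPd i]
  -- This keeps σ = Θ + η strictly between 0 and 1, even when Θ = 0.
  set η := min (ε / 2) ((1 - Θ) / 2) with hη
  have hη0 : 0 < η := lt_min (by linarith) (by linarith)
  have hη1 : η ≤ ε / 2 := min_le_left _ _
  have hη2 : η ≤ (1 - Θ) / 2 := min_le_right _ _
  set σ := Θ + η with hσ
  -- Here rδ ≤ σ/2 gives σ + (r-1)(1-δ) > 1, and rδ ≤ ε/2 keeps the final exponent within r - 1 + Θ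
  -- + ε.
  set δ := σ / 2 * (min ε 1 / r) with hδ
  have hm : 0 < min ε 1 := lt_min hε one_pos
  have hσ0 : 0 < σ := by linarith
  have hσ1 : σ < 1 := by linarith
  have hδ0 : 0 < δ := by positivity
  have hrδ : r * δ = σ / 2 * min ε 1 := by
    rw [hδ]
    field_simp
  have hrδ1 : r * δ ≤ σ / 2 := by
    rw [hrδ]
    exact mul_le_of_le_one_right (by linarith) (min_le_right _ _)
  have hrδ2 : r * δ ≤ ε / 2 := by
    rw [hrδ]
    nlinarith [min_le_left ε 1]
  have hδ1 : δ ≤ 1 := by nlinarith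
  have hnn : ∀ x, 0 < x → 0 ≤ nearLinear δ x := fun x hx => nearLinear_nonneg δ hx
  obtain ⟨C₁, hC₁, h₁⟩ := exists_uniform_bound
    (F := fun i => summatory ((ζ : ArithmeticFunction ℝ) ^ t i)) hnn fun i => by
      obtain ⟨C, hC, h⟩ := exists_abs_summatory_zeta_pow_le (t i) hδ0
      exact ⟨C, hC, fun x hx => (h x hx).trans
        (mul_le_mul_of_nonneg_left (rpow_le_nearLinear δ hx) hC)⟩
  obtain ⟨C₂, hC₂, h₂⟩ := exists_uniform_bound
    (F := fun i x => x * (P i).eval (Real.log x)) hnn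
    fun i => exists_abs_mul_eval_log_le (P i) hδ0
  obtain ⟨C₃, hC₃, h₃⟩ := exists_uniform_bound (w := fun x => x ^ σ)
    (F := fun i x => summatory ((ζ : ArithmeticFunction ℝ) ^ t i) x - x * (P i).eval (Real.log x))
    (fun x hx => by positivity) fun i => by
      refine exists_abs_summatory_sub_le hσ0.le hσ1 ?_
      have := hP i (σ - piltzExponent (t i)) (by linarith [hΘ i])
      simpa only [sum_piltzTau_eq_summatory, add_sub_cancel] using this
  have hC : 0 ≤ C₁ + C₂ + C₃ := by positivity
  obtain ⟨g, hg, hbound⟩ := exists_summable_bound_prod_sub_prod (t := t) hC hδ0.le hδ1 hσ0.le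
    (by omega) (by nlinarith)
    (fun i y hy => (h₁ i y hy).trans (mul_le_mul_of_nonneg_right (by linarith) (hnn y hy)))
    (fun i y hy => (h₂ i y hy).trans (mul_le_mul_of_nonneg_right (by linarith) (hnn y hy)))
    (fun i y hy => (h₃ i y hy).trans (mul_le_mul_of_nonneg_right (by linarith) (by positivity)))
  refine IsBigO.trans (g := fun x : ℝ => x ^ (σ + (r - 1) * (1 + δ))) ?_
    (rpow_isBigO_rpow (by nlinarith))
  refine IsBigO.of_bound (∑' s, g s) ?_
  filter_upwards [eventually_ge_atTop 1] with x hx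
  have hs : HasSum (fun s : Finset Nat.Primes => (-1) ^ s.card *
      ∏ i, radicalOperator (t i) s.toList (summatory ((ζ : ArithmeticFunction ℝ) ^ t i)) x)
      (coprimeTauSum t x) := by
    rw [coprimeTauSum_eq_sum (by omega)]
    refine hasSum_sum_of_ne_finset_zero fun s hs => ?_
    rw [Finset.prod_eq_zero (Finset.mem_univ (⟨0, by omega⟩ : Fin r))
      (radicalOperator_summatory_eq_zero _ hs), mul_zero]
  rw [Real.norm_of_nonneg (by positivity : 0 ≤ x ^ (σ + (r - 1) * (1 + δ)))]
  refine (hs.sub (hQ x hx)).norm_le_of_bounded (hg.hasSum.mul_right _) fun s => ?_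
  rw [← mul_sub, norm_mul, norm_pow, norm_neg, norm_one, one_pow, one_mul]
  exact hbound s x hx

theorem theorem4 (r : ℕ) (hr : 2 ≤ r) (t : Fin r → ℕ) (ht : ∀ i, 2 ≤ t i) :
    Multipliable (fun p : Nat.Primes => deltaFactor t (p : ℕ)) ∧
    ∃ Q : Polynomial ℝ,
      Q.natDegree = (∑ i, t i) - r ∧
      Q.leadingCoeff = deltaOne t / ∏ i, ((t i - 1).factorial : ℝ) ∧
      ∀ ε : ℝ, 0 < ε →
        (fun x : ℝ => coprimeTauSum t x - x ^ r * Q.eval (Real.log x))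
          =O[atTop] fun x : ℝ => x ^ ((r : ℝ) - 1 + (⨆ i, piltzExponent (t i)) + ε) := by
  refine ⟨?_, ?_⟩
  · simp only [deltaFactor_eq (show 0 < r by omega)]
    exact multipliable_one_add_of_summable (summable_norm_deltaTerm hr t)
  have hne : deltaOne t / ∏ i, ((t i - 1).factorial : ℝ) ≠ 0 :=
    div_ne_zero (deltaOne_ne_zero hr t) (by positivity)
  have hle : ∀ i, piltzExponent (t i) ≤ ⨆ i, piltzExponent (t i) :=
    le_ciSup (Set.finite_range _).bddAbove
  have hdeg : ∑ i, (t i - 1) = (∑ i, t i) - r := by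
    rw [Finset.sum_tsub_distrib _ fun i _ => (by linarith [ht i] : 1 ≤ t i)]
    simp
  rcases lt_or_ge (⨆ i, piltzExponent (t i)) 1 with h | h
  · have hr0 : 0 < r := by omega
    obtain ⟨Q, hQd, hQc, hQ⟩ := exists_polynomial_of_piltzExponent_lt_one hr
      ((piltzExponent_nonneg (one_le_two.trans (ht ⟨0, hr0⟩))).trans (hle ⟨0, hr0⟩)) h hle
    have hc : Q.coeff (∑ i, (t i - 1)) = deltaOne t / ∏ i, ((t i - 1).factorial : ℝ) := by
      rw [hQc, div_eq_mul_one_div, Finset.prod_div_distrib, Finset.prod_const_one]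
    have hd : Q.natDegree = ∑ i, (t i - 1) :=
      Polynomial.natDegree_eq_of_le_of_coeff_ne_zero hQd (hc ▸ hne)
    exact ⟨Q, hd.trans hdeg, by rw [Polynomial.leadingCoeff, hd, hc], hQ⟩
  -- The permitted error is now at least x^(r+ε) for x ≥ 1, which dominates both the sum and the
  -- main term, so a bare leading monomial suffices.
  · refine ⟨Polynomial.C (deltaOne t / ∏ i, ((t i - 1).factorial : ℝ)) *
      Polynomial.X ^ ((∑ i, t i) - r), Polynomial.natDegree_C_mul_X_pow _ _ hne,
      Polynomial.leadingCoeff_C_mul_X_pow _ _, fun ε hε => ?_⟩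
    exact ((coprimeTauSum_isBigO t hε).sub (pow_mul_eval_log_isBigO (by omega) _ hε)).trans
      (rpow_isBigO_rpow (by linarith))
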